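/- Let $n\in\{1,2,3,\dots\}\cup\{\omega\}$ and $m\in\mathbb N$, and let $\mathrm{Fm}(n,m)$ be the set of formulas of propositional modal logic with modalities $[i]$, $i<n$, and variables $p_0,\dots,p_{m-1}$; put $\langle i\rangle\varphi:=\neg[i]\neg\varphi$. Let $\mathbf{GLP}_n\subseteq\mathrm{Fm}(n,m)$ be the smallest set of formulas that contains all classical propositional tautologies and all formulas $[i](\varphi\to\psi)\to([i]\varphi\to[i]\psi)$; $[i]([i]\varphi\to\varphi)\to[i]\varphi$; $\langle i\rangle\varphi\to[j]\langle i\rangle\varphi$ for $i<j$; $[i]\varphi\to[j]\varphi$ for $i\le j$ (with $i,j<n$), and that is closed under modus ponens and necessitation (from $\varphi$ infer $[i]\varphi$). Write $\mathbf{GLP}=\mathbf{GLP}_\omega$, and let $\mathbf{GL}$ be the Gödel–Löb logic, given in the language with the single modality $[0]$ by the tautologies, the first two schemata for $i=0$, modus ponens and necessitation. Let $L\subseteq\mathrm{Fm}(n,m)$ be a logic. A substitution is a map $\sigma:\mathrm{Fm}(n,m)\to\mathrm{Fm}(n,m)$ preserving all connectives and modalities. It is a unifier of $\varphi$ in $L$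 if $L\vdash\sigma(\varphi)$, and $\varphi$ is unifiable in $L$ if it has a unifier in $L$. Write $\tau\le\sigma$ if there is a substitution $\theta$ with $L\vdash\tau(p)\leftrightarrow\theta(\sigma(p))$ for all variables $p$, and $\sigma<\tau$ if $\sigma\le\tau$ and not $\tau\le\sigma$. A unifier $\sigma$ of $\varphi$ is maximal if there is no unifier $\tau$ of $\varphi$ with $\sigma<\tau$. A set $\Sigma$ of unifiers of $\varphi$ is complete if every unifier $\tau$ of $\varphi$ satisfies $\tau\le\sigma$ for some $\sigma\in\Sigma$. The logic $L$ is finitary if every unifiable formula has a finite complete set of maximal unifiers; it is infinitary if it is not finitary but every unifiable formula has a complete set of maximal unifiers; it is nullary if it is neither finitary nor infinitary, that is, if some unifiable formula has no complete set of maximal unifiers. Then: 1. For every $n$ with $1<n<\omega$, every $m\ge1$ and every variable $p\in\{p_0,\dots,p_{m-1}\}$, the formula $[1]p$ is unifiable in $\mathbf{GLP}_n$ but has no maximal unifier in $\mathbf{GLP}_n$. The unification type of $\mathbf{GLP}_n$ is nullary. 2. The same holds for $\mathbf{GLP}$, the logic in the full language with modalities $[0],[1],[2],\dots$ and $m\ge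 1$ variables. 3. By contrast, for every $m\ge 0$, $\mathbf{GLP}_1=\mathbf{GL}$, and the unification type of this logic is finitary. -/

import Mathlib

namespace PolyModal

/-- Formulas of propositional polymodal logic with modalities `[i]`, `i : I`, and propositional
variables from `V`.  The connectives `⊥` and `→` are primitive, the other Boolean connectives are
the usual classical abbreviations.  The language with `n` modalities `[0], …, [n-1]` and `m`
variables is `Formula (Fin n) (Fin m)`. -/
inductive Formula (I V : Type) : Type
  | var : V → Formula I V
  | bot : Formula I V
  | imp : Formula I V → Formula I V → Formula I V
  | box : I → Formula I V → Formula I V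

namespace Formula

variable {I V : Type}

/-- Negation. -/
def neg (φ : Formula I V) : Formula I V := imp φ bot

/-- Conjunction. -/
def and (φ ψ : Formula I V) : Formula I V := neg (imp φ (neg ψ))

/-- Biconditional. -/
def iff (φ ψ : Formula I V) : Formula I V := and (imp φ ψ) (imp ψ φ)

/-- The dual modality `⟨i⟩φ = ¬[i]¬φ`. -/
def dia (i : I) (φ : Formula I V) : Formula I V := neg (box i (neg φ))

/-- Truth value of a formula under the assignment `a` of truth values to its propositional atoms,
where variables and formulas beginning with a modality count as atoms. -/
def eval (a : Formula I V → Prop) : Formula I V → Prop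
  | var p => a (var p)
  | bot => False
  | imp φ ψ => eval a φ → eval a ψ
  | box i φ => a (box i φ)

/-- Tautologies of classical propositional calculus (in the polymodal language). -/
def IsTautology (φ : Formula I V) : Prop := ∀ a : Formula I V → Prop, eval a φ

/-- The action on formulas of the substitution `p ↦ σ p`: the unique map extending `σ` and
preserving all connectives and modalities. -/
def subst (σ : V → Formula I V) : Formula I V → Formula I V
  | var p => σ p
  | bot => bot
  | imp φ ψ => imp (subst σ φ) (subst σ ψ)
  | box i φ => box i (subst σ φ)

end Formula

open Formula

/-- Derivability in Japaridze's provability logic with modalities indexed by `I`. -/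
inductive GLPProvable {I V : Type} [LinearOrder I] : Formula I V → Prop
  | taut {φ : Formula I V} : IsTautology φ → GLPProvable φ
  | distr (i : I) (φ ψ : Formula I V) :
      GLPProvable (imp (box i (imp φ ψ)) (imp (box i φ) (box i ψ)))
  | loeb (i : I) (φ : Formula I V) :
      GLPProvable (imp (box i (imp (box i φ) φ)) (box i φ))
  | dia_box {i j : I} (hij : i < j) (φ : Formula I V) :
      GLPProvable (imp (dia i φ) (box j (dia i φ)))
  | mono {i j : I} (hij : i ≤ j) (φ : Formula I V) :
      GLPProvable (imp (box i φ) (box j φ))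
  | mp {φ ψ : Formula I V} : GLPProvable (imp φ ψ) → GLPProvable φ → GLPProvable ψ
  | nec (i : I) {φ : Formula I V} : GLPProvable φ → GLPProvable (box i φ)

/-- The logic GLP with modalities `I` in the variables `V`, as the set of its theorems. For
`I = Fin n` this is the logic with the `n` modalities `[0], …, [n-1]`, for `I = ℕ` the full
logic. -/
def GLP (I V : Type) [LinearOrder I] : Set (Formula I V) := {φ | GLPProvable φ}

/-- Derivability in the Gödel–Löb logic GL, whose single modality is written `[0]`. -/
inductive GLProvable {V : Type} : Formula (Fin 1) V → Prop
  | taut {φ : Formula (Fin 1) V} : IsTautology φ → GLProvable φ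
  | distr (φ ψ : Formula (Fin 1) V) :
      GLProvable (imp (box 0 (imp φ ψ)) (imp (box 0 φ) (box 0 ψ)))
  | loeb (φ : Formula (Fin 1) V) :
      GLProvable (imp (box 0 (imp (box 0 φ) φ)) (box 0 φ))
  | mp {φ ψ : Formula (Fin 1) V} : GLProvable (imp φ ψ) → GLProvable φ → GLProvable ψ
  | nec {φ : Formula (Fin 1) V} : GLProvable φ → GLProvable (box 0 φ)

/-- The Gödel–Löb logic GL in the variables `V`, as the set of its theorems. -/
def GLLogic (V : Type) : Set (Formula (Fin 1) V) := {φ | GLProvable φ}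

section Unification

variable {I V : Type}

/-- The set of all unifiers of `φ` in the logic `L`. -/
def unifiers (L : Set (Formula I V)) (φ : Formula I V) : Set (V → Formula I V) :=
  {σ | subst σ φ ∈ L}

/-- `φ` is unifiable in `L`. -/
def IsUnifiable (L : Set (Formula I V)) (φ : Formula I V) : Prop :=
  (unifiers L φ).Nonempty

/-- `τ ≤ σ` in `L`: the substitution `σ` is more general than `τ`, that is, `τ = θσ` in `L` for
some substitution `θ`. -/
def LessGeneral (L : Set (Formula I V)) (τ σ : V → Formula I V) : Prop :=
  ∃ θ : V → Formula I V, ∀ p : V, iff (τ p) (subst θ (σ p)) ∈ L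

/-- `τ < σ` in `L`. -/
def StrictlyLessGeneral (L : Set (Formula I V)) (τ σ : V → Formula I V) : Prop :=
  LessGeneral L τ σ ∧ ¬ LessGeneral L σ τ

/-- `σ` is a maximal unifier of `φ` in `L`. -/
def IsMaximalUnifier (L : Set (Formula I V)) (φ : Formula I V) (σ : V → Formula I V) : Prop :=
  σ ∈ unifiers L φ ∧ ¬ ∃ τ ∈ unifiers L φ, StrictlyLessGeneral L σ τ

/-- `S` is a complete set of unifiers of `φ` in `L`. -/
def IsCompleteSet (L : Set (Formula I V)) (φ : Formula I V) (S : Set (V → Formula I V)) : Prop :=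
  S ⊆ unifiers L φ ∧ ∀ τ ∈ unifiers L φ, ∃ σ ∈ S, LessGeneral L τ σ

/-- `S` is a complete set of maximal unifiers of `φ` in `L`. -/
def IsCompleteSetOfMaximal (L : Set (Formula I V)) (φ : Formula I V)
    (S : Set (V → Formula I V)) : Prop :=
  IsCompleteSet L φ S ∧ ∀ σ ∈ S, IsMaximalUnifier L φ σ

/-- `L` has finitary unification type: every unifiable formula has a finite complete set of
maximal unifiers. -/
def IsFinitary (L : Set (Formula I V)) : Prop :=
  ∀ φ : Formula I V, IsUnifiable L φ → ∃ S, S.Finite ∧ IsCompleteSetOfMaximal L φ S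

/-- `L` has infinitary unification type: every unifiable formula has a complete set of maximal
unifiers, but these sets cannot always be chosen finite. -/
def IsInfinitary (L : Set (Formula I V)) : Prop :=
  (∀ φ : Formula I V, IsUnifiable L φ → ∃ S, IsCompleteSetOfMaximal L φ S) ∧ ¬ IsFinitary L

/-- `L` has nullary unification type: it is neither finitary nor infinitary. -/
def IsNullary (L : Set (Formula I V)) : Prop :=
  ¬ IsFinitary L ∧ ¬ IsInfinitary L

/-- Equivalently, some unifiable formula has no complete set of maximal unifiers. -/
theorem isNullary_iff (L : Set (Formula I V)) :
    IsNullary L ↔ ∃ φ, IsUnifiable L φ ∧ ¬ ∃ S, IsCompleteSetOfMaximal L φ S := by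
  constructor
  · rintro ⟨h1, h2⟩
    by_contra h
    refine h2 ⟨fun φ hφ => ?_, h1⟩
    by_contra hS
    exact h ⟨φ, hφ, hS⟩
  · rintro ⟨φ, hφ, hS⟩
    refine ⟨fun h => ?_, fun h => hS (h.1 φ hφ)⟩
    obtain ⟨S, -, hS'⟩ := h φ hφ
    exact hS ⟨S, hS'⟩

end Unification

end PolyModal

namespace PolyModal

open Formula

variable {I V : Type}

/-! ### Theories -/

/-! Nullarity. Let σ unify `[1]p` and put ψ = σ(p). If GLP proves `[1]ψ`, then it refutes `chain z ψ
k` for some k (`exists_not_chain`): the `[0]`-chains of points refuting ψ have bounded length. The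
substitution p ↦ ¬p → ⟨0⟩chain_k(p) is again a unifier (`box_chain`), and following it by σ gives σ
back, because ⟨0⟩chain_k(ψ) is refutable. It is not an instance of σ: over (ℕ, >) with p false
everywhere its value fails at 0, …, k, which is too long a chain for any instance of ψ. So every
unifier lies strictly below another one.

The bound is obtained without Kripke models for `[1]`. If no chain were refutable, a maximal set F
of formulas closed under modus ponens and `[0]`-necessitation and containing no negated chain would
serve as the theory of everything `[0]`-above a new root. From F a theory G for `[1]` is read off,
and the truth assignment that interprets the boxes by F and G satisfies every theorem but refutes
`[1]ψ`.

Finitarity of GL follows Ghilardi's method. Fix φ and record at each world its variables and the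
boxed subformulas of φ true there; there are finitely many such types. The set of types realized
under a unifier is extensible, since models can be glued below a new root (`extensible_realized`).
Conversely, an extensible set X yields a substitution σ_X that moves every world of every model into
X and changes nothing in models already inside X (`newTyp_mem`, `newTyp_of_mem`,
`exists_subst_newTyp`). Hence a unifier τ realizing exactly X satisfies τ = τσ_X, and the finitely
many σ_X, for extensible X all of whose types satisfy φ, form a complete set. -/

/-- A set of formulas containing all theorems of GLP and closed under modus ponens. -/
structure IsTheory [LinearOrder I] (T : Set (Formula I V)) : Prop where
  prov : ∀ {φ}, GLPProvable φ → φ ∈ T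
  mp : ∀ {φ ψ}, imp φ ψ ∈ T → φ ∈ T → ψ ∈ T

section Theories

variable [LinearOrder I]

lemma isTheory_GLP : IsTheory (GLP I V) := ⟨fun h => h, fun h h' => GLPProvable.mp h h'⟩

lemma isTheory_sUnion {c : Set (Set (Formula I V))} (hc : IsChain (· ⊆ ·) c) (hne : c.Nonempty)
    (h : ∀ T ∈ c, IsTheory T) : IsTheory (⋃₀ c) := by
  refine ⟨fun {φ} hφ => ?_, fun {φ ψ} h1 h2 => ?_⟩
  · obtain ⟨T, hT⟩ := hne
    exact ⟨T, hT, (h T hT).prov hφ⟩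
  · obtain ⟨T, hT, h1⟩ := h1
    obtain ⟨U, hU, h2⟩ := h2
    rcases hc.total hT hU with hTU | hTU
    · exact ⟨U, hU, (h U hU).mp (hTU h1) h2⟩
    · exact ⟨T, hT, (h T hT).mp h1 (hTU h2)⟩

lemma IsTheory.imp_left {T : Set (Formula I V)} (hT : IsTheory T) (χ : Formula I V) :
    IsTheory {ξ | imp χ ξ ∈ T} := by
  refine ⟨fun {φ} hφ => ?_, fun {φ ψ} h1 h2 => ?_⟩
  · refine hT.mp (hT.prov (.taut (φ := imp φ (imp χ φ)) ?_)) (hT.prov hφ)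
    intro a; simp only [eval]; tauto
  · refine hT.mp (hT.mp (hT.prov (.taut
      (φ := imp (imp χ (imp φ ψ)) (imp (imp χ φ) (imp χ ψ))) ?_)) h1) h2
    intro a; simp only [eval]; tauto

lemma IsTheory.subset_imp_left {T : Set (Formula I V)} (hT : IsTheory T) (χ : Formula I V) :
    T ⊆ {ξ | imp χ ξ ∈ T} := by
  intro φ hφ
  refine hT.mp (hT.prov (.taut (φ := imp φ (imp χ φ)) ?_)) hφ
  intro a; simp only [eval]; tauto

/-- Lindenbaum's lemma. -/
lemma IsTheory.exists_eval {T : Set (Formula I V)} (hT : IsTheory T) {φ : Formula I V}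
    (hφ : φ ∉ T) : ∃ a : Formula I V → Prop, (∀ χ ∈ T, eval a χ) ∧ ¬ eval a φ := by
  obtain ⟨M, hTM, hM⟩ := zorn_subset_nonempty {S : Set (Formula I V) | IsTheory S ∧ φ ∉ S}
    (fun c hc hch hne => ⟨⋃₀ c, ⟨isTheory_sUnion hch hne fun S hS => (hc hS).1,
      fun ⟨S, hS, h⟩ => (hc hS).2 h⟩, fun S hS => Set.subset_sUnion_of_mem hS⟩) T ⟨hT, hφ⟩
  have hth : IsTheory M := hM.prop.1
  -- Adjoining χ to M must produce φ, by maximality among the theories omitting φ.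
  have key : ∀ χ, χ ∉ M → imp χ φ ∈ M := by
    intro χ hχ
    by_contra h
    have h2 := hM.le_of_ge (y := {ξ | imp χ ξ ∈ M}) ⟨hth.imp_left χ, h⟩ (hth.subset_imp_left χ)
    exact hχ (h2 (hth.prov (.taut fun a h => h)))
  have main : ∀ χ, eval (fun ξ => ξ ∈ M) χ ↔ χ ∈ M := by
    intro χ
    induction χ with
    | var p => rfl
    | box i χ => rfl
    | bot =>
      refine ⟨False.elim, fun h => hM.prop.2 (hth.mp (hth.prov (.taut ?_)) h)⟩
      intro a; exact False.elim
    | imp χ ξ ih1 ih2 =>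
      simp only [eval, ih1, ih2]
      refine ⟨fun h => ?_, hth.mp⟩
      by_cases hχ : χ ∈ M
      · exact hth.subset_imp_left χ (h hχ)
      · by_contra hn
        refine hM.prop.2 (hth.mp (hth.mp (hth.prov (.taut
          (φ := imp (imp χ φ) (imp (imp (imp χ ξ) φ) φ)) ?_)) (key _ hχ)) (key _ hn))
        intro a; simp only [eval]; tauto
  exact ⟨_, fun χ hχ => (main χ).2 (hTM hχ), fun h => hM.prop.2 ((main φ).1 h)⟩

/-- Replaces propositional derivations inside a theory by reasoning about truth assignments. -/
lemma IsTheory.mem_of_eval {T : Set (Formula I V)} (hT : IsTheory T) {φ : Formula I V}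
    (h : ∀ a : Formula I V → Prop, (∀ χ ∈ T, eval a χ) → eval a φ) : φ ∈ T := by
  by_contra hφ
  obtain ⟨a, h1, h2⟩ := hT.exists_eval hφ
  exact h2 (h a h1)

namespace GLPProvable

lemma box_mono {φ ψ : Formula I V} (i : I) (h : GLPProvable (imp φ ψ)) :
    GLPProvable (imp (box i φ) (box i ψ)) := (distr i φ ψ).mp (nec i h)

lemma of_eval {φ : Formula I V}
    (h : ∀ a : Formula I V → Prop, (∀ χ, GLPProvable χ → eval a χ) → eval a φ) :
    GLPProvable φ := isTheory_GLP.mem_of_eval h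

/-- Löb's axiom applied to φ ∧ [i]φ. -/
lemma four (i : I) (φ : Formula I V) : GLPProvable (imp (box i φ) (box i (box i φ))) := by
  have h1 : GLPProvable (imp (box i (Formula.and φ (box i φ))) (box i φ)) :=
    box_mono i (.taut fun a => by simp only [Formula.and, neg, eval]; tauto)
  have h2 : GLPProvable (imp φ (imp (box i (Formula.and φ (box i φ)))
      (Formula.and φ (box i φ)))) := of_eval fun a ha => by
    have := ha _ h1
    simp only [Formula.and, neg, eval] at this ⊢; tauto
  have h3 := box_mono i h2
  have h4 := loeb i (Formula.and φ (box i φ))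
  have h5 : GLPProvable (imp (box i (Formula.and φ (box i φ))) (box i (box i φ))) :=
    box_mono i (.taut fun a => by simp only [Formula.and, neg, eval]; tauto)
  exact of_eval fun a ha => fun h => ha _ h5 (ha _ h4 (ha _ h3 h))

lemma dia_mono {φ ψ : Formula I V} (i : I) (h : GLPProvable (imp φ ψ)) :
    GLPProvable (imp (dia i φ) (dia i ψ)) := by
  have h1 : GLPProvable (imp (box i (neg ψ)) (box i (neg φ))) :=
    box_mono i (of_eval fun a ha => by
      have := ha _ h
      simp only [neg, eval] at this ⊢; tauto)
  refine of_eval fun a ha => ?_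
  have := ha _ h1
  simp only [dia, neg, eval] at this ⊢; tauto

end GLPProvable

end Theories

/-! ### Unifiers of `[1]p` in GLP -/

/-- The formula expressing that there is an `R_z`-chain of `k` points refuting `ψ`, beginning at
the point of evaluation. -/
def chain (z : I) (ψ : Formula I V) : ℕ → Formula I V
  | 0 => neg bot
  | k + 1 => Formula.and (neg ψ) (dia z (chain z ψ k))

lemma subst_chain (z : I) (σ : V → Formula I V) (ψ : Formula I V) (k : ℕ) :
    subst σ (chain z ψ k) = chain z (subst σ ψ) k := by
  induction k with
  | zero => rfl
  | succ k ih => simp only [chain, Formula.and, neg, dia, subst, ih]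

section GLP

variable [LinearOrder I]

lemma chain_antitone (z : I) (ψ : Formula I V) {k l : ℕ} (hkl : k ≤ l) :
    GLPProvable (imp (chain z ψ l) (chain z ψ k)) := by
  have step : ∀ k, GLPProvable (imp (chain z ψ (k + 1)) (chain z ψ k)) := by
    intro k
    induction k with
    | zero => exact .taut fun a _ h => h
    | succ k ih =>
      have := GLPProvable.dia_mono z ih
      refine GLPProvable.of_eval fun a ha => ?_
      have := ha _ this
      rw [chain, chain]
      simp only [Formula.and, neg, eval] at this ⊢
      tauto
  induction l, hkl using Nat.le_induction with
  | base => exact .taut fun a h => h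
  | succ l _ ih => exact GLPProvable.of_eval fun a ha h => ha _ ih (ha _ (step l) h)

/-- If `[o]ψ` is provable then chains of points refuting `ψ` have bounded length. -/
theorem exists_not_chain {z o : I} (hzo : z < o) (hz : ∀ i, i < o → i = z) {ψ : Formula I V}
    (hψ : GLPProvable (box o ψ)) : ∃ k, GLPProvable (neg (chain z ψ k)) := by
  by_contra! hcon
  obtain ⟨F, -, hF⟩ := zorn_subset_nonempty {S : Set (Formula I V) |
      IsTheory S ∧ (∀ φ ∈ S, box z φ ∈ S) ∧ ∀ k, neg (chain z ψ k) ∉ S}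
    (fun c hc hch hne => ⟨⋃₀ c, ⟨isTheory_sUnion hch hne fun S hS => (hc hS).1,
      fun φ ⟨S, hS, h⟩ => ⟨S, hS, (hc hS).2.1 _ h⟩,
      fun k ⟨S, hS, h⟩ => (hc hS).2.2 k h⟩, fun S hS => Set.subset_sUnion_of_mem hS⟩)
    (GLP I V) ⟨isTheory_GLP, fun φ h => GLPProvable.nec z h, hcon⟩
  obtain ⟨hT, hnec, hch⟩ := hF.prop
  have hneco : ∀ φ ∈ F, box o φ ∈ F := fun φ h =>
    hT.mp (hT.prov (.mono hzo.le φ)) (hnec φ h)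
  have hloeb : ∀ i, (∀ φ ∈ F, box i φ ∈ F) → ∀ φ, imp (box i φ) φ ∈ F → φ ∈ F :=
    fun i hi φ h => hT.mp h (hT.mp (hT.prov (.loeb i φ)) (hi _ h))
  -- If F does not refute α, then F proves that ⟨z⟩α fails only where the chains above are bounded.
  -- Otherwise χ = ¬α ∧ [z]¬α could be adjoined to F without producing a negated chain, and
  -- maximality would put ¬α into F.
  have hmax : ∀ α, neg α ∉ F → ∃ K, imp (neg (dia z α)) (box z (neg (chain z ψ K))) ∈ F := by
    intro α hα
    by_contra! hK
    set χ := Formula.and (neg α) (box z (neg α)) with hχ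
    have h1 : GLPProvable (imp χ (box z χ)) := by
      have h1 : GLPProvable (imp (neg α) (imp (box z (neg α)) χ)) :=
        .taut fun a => by simp only [hχ, Formula.and, neg, eval]; tauto
      have h2 := GLPProvable.box_mono z h1
      have h3 := GLPProvable.distr z (box z (neg α)) χ
      have h4 := GLPProvable.four z (neg α)
      refine GLPProvable.of_eval fun a ha => ?_
      have h2 := ha _ h2
      have h3 := ha _ h3
      have h4 := ha _ h4
      simp only [hχ, Formula.and, neg, eval] at h2 h3 h4 ⊢
      tauto
    have h2 : GLPProvable (imp (neg (dia z α)) (box z χ)) := by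
      have h1 : GLPProvable (imp (neg α) (imp (box z (neg α)) χ)) :=
        .taut fun a => by simp only [hχ, Formula.and, neg, eval]; tauto
      have h2 := GLPProvable.box_mono z h1
      have h3 := GLPProvable.distr z (box z (neg α)) χ
      have h4 := GLPProvable.four z (neg α)
      refine GLPProvable.of_eval fun a ha => ?_
      have h2 := ha _ h2
      have h3 := ha _ h3
      have h4 := ha _ h4
      simp only [hχ, Formula.and, dia, neg, eval] at h2 h3 h4 ⊢
      tauto
    have hle := hF.le_of_ge (y := {ξ | imp χ ξ ∈ F}) ⟨hT.imp_left χ, ?_, ?_⟩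
      (hT.subset_imp_left χ)
    · refine hα (hle (hT.prov (.taut fun a => ?_)))
      simp only [hχ, Formula.and, neg, eval]; tauto
    · intro φ h
      have h3 := hT.mp (hT.prov (.distr z χ φ)) (hnec _ h)
      exact hT.mem_of_eval fun a ha h => ha _ h3 (ha _ (hT.prov h1) h)
    · intro K h
      have h3 := hT.mp (hT.prov (.distr z χ _)) (hnec _ h)
      exact hK K (hT.mem_of_eval fun a ha h => ha _ h3 (ha _ (hT.prov h2) h))
  -- the set of formulas `[o]`-true at the new root
  let G : Set (Formula I V) := {χ | ∃ e, imp e (box o e) ∈ F ∧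
    (∃ K, imp (neg e) (box z (neg (chain z ψ K))) ∈ F) ∧ imp e χ ∈ F}
  -- A witness e for membership in G is persistent along `[o]`, and its failure bounds the chains
  -- above. Here e = ⊤, which never fails, so K = 0 will do.
  have hFG : F ⊆ G := fun φ h => by
    refine ⟨neg bot, hT.subset_imp_left _ (hneco _ (hT.prov (.taut fun a h => h))),
      ⟨0, hT.prov (.taut fun a => ?_)⟩, hT.subset_imp_left _ h⟩
    simp only [neg, eval]; tauto
  have hGmp : ∀ φ χ, imp φ χ ∈ G → φ ∈ G → χ ∈ G := by
    rintro φ χ ⟨e, h1, ⟨K, h2⟩, h3⟩ ⟨f, g1, ⟨L, g2⟩, g3⟩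
    -- Witnesses are closed under conjunction; the larger bound serves both, since longer chains
    -- contain shorter ones.
    refine ⟨Formula.and e f, ?_, ⟨max K L, ?_⟩, ?_⟩
    · have h4 : GLPProvable (imp e (imp f (Formula.and e f))) :=
        .taut fun a => by simp only [Formula.and, neg, eval]; tauto
      have h5 := GLPProvable.box_mono o h4
      have h6 := GLPProvable.distr o f (Formula.and e f)
      refine hT.mem_of_eval fun a ha => ?_
      have h1 := ha _ h1
      have g1 := ha _ g1
      have h5 := ha _ (hT.prov h5)
      have h6 := ha _ (hT.prov h6)
      simp only [Formula.and, neg, eval] at h1 g1 h5 h6 ⊢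
      tauto
    · have aux : ∀ {k l}, k ≤ l →
          GLPProvable (imp (box z (neg (chain z ψ k))) (box z (neg (chain z ψ l)))) := by
        intro k l hkl
        refine GLPProvable.box_mono z (GLPProvable.of_eval fun a ha h h' => h ?_)
        exact ha _ (chain_antitone z ψ hkl) h'
      have h4 := aux (le_max_left K L)
      have h5 := aux (le_max_right K L)
      refine hT.mem_of_eval fun a ha => ?_
      have h4 := ha _ (hT.prov h4)
      have h5 := ha _ (hT.prov h5)
      have h2 := ha _ h2
      have g2 := ha _ g2
      simp only [Formula.and, neg, eval] at h2 g2 h4 h5 ⊢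
      tauto
    · refine hT.mem_of_eval fun a ha => ?_
      have h3 := ha _ h3
      have g3 := ha _ g3
      simp only [Formula.and, neg, eval] at h3 g3 ⊢
      tauto
  have hGloeb : ∀ φ, imp (box o φ) φ ∈ G → φ ∈ G := by
    rintro φ ⟨e, h1, h2, h3⟩
    refine ⟨e, h1, h2, hloeb o hneco _ ?_⟩
    have h4 := GLPProvable.distr o e φ
    refine hT.mem_of_eval fun a ha => ?_
    have h1 := ha _ h1
    have h3 := ha _ h3
    have h4 := ha _ (hT.prov h4)
    simp only [eval] at h1 h3 h4 ⊢
    tauto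
  -- ⟨z⟩φ is its own witness: persistent by the axiom ⟨z⟩φ → [o]⟨z⟩φ, with bounded failure by
  -- `hmax`.
  have hGdia : ∀ φ, neg φ ∉ F → dia z φ ∈ G := fun φ h =>
    ⟨dia z φ, hT.prov (.dia_box hzo φ), hmax φ h, hT.prov (.taut fun a h => h)⟩
  -- If e implied ψ, a point refuting ψ would refute e and so have no chain of length K above it; F
  -- would then contain the negation of the chain of length K + 1.
  have hψG : ψ ∉ G := by
    rintro ⟨e, -, ⟨K, h2⟩, h3⟩
    refine hch (K + 1) (hT.mem_of_eval fun a ha => ?_)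
    have h2 := ha _ h2
    have h3 := ha _ h3
    rw [chain]
    simp only [Formula.and, dia, neg, eval] at h2 h3 ⊢
    tauto
  -- For modalities other than z and o both conditions are vacuous, so all their boxes hold at the
  -- root.
  let H : I → Set (Formula I V) := fun i => {χ | (i = z → χ ∈ F) ∧ (i = o → χ ∈ G)}
  let r : Formula I V → Prop := fun χ => match χ with
    | box i χ => χ ∈ H i
    | _ => False
  have hr : ∀ φ : Formula I V, GLPProvable φ → eval r φ := by
    intro φ hφ
    induction hφ with
    | taut h => exact h r
    | distr i φ ψ =>
      exact fun h1 h2 => ⟨fun hi => hT.mp (h1.1 hi) (h2.1 hi),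
        fun hi => hGmp _ _ (h1.2 hi) (h2.2 hi)⟩
    | loeb i φ =>
      exact fun h => ⟨fun hi => hloeb z hnec _ (hi ▸ h.1 hi), fun hi => hGloeb _ (hi ▸ h.2 hi)⟩
    | @dia_box i j hij φ =>
      intro h
      have hjz : j ≠ z := by
        rintro rfl
        exact hij.ne (hz i (hij.trans hzo))
      refine ⟨fun h => (hjz h).elim, ?_⟩
      rintro rfl
      obtain rfl := hz i hij
      refine hGdia φ fun h' => h ⟨fun _ => h', fun h'' => (hij.ne h'').elim⟩
    | @mono i j hij φ =>
      intro h
      rcases hij.eq_or_lt with rfl | hlt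
      · exact h
      refine ⟨?_, ?_⟩
      · rintro rfl
        exact (hlt.ne (hz i (hlt.trans hzo))).elim
      · rintro rfl
        exact hFG (h.1 (hz i hlt))
    | mp _ _ h1 h2 => exact h1 h2
    | nec i h _ => exact ⟨fun _ => hT.prov h, fun _ => hFG (hT.prov h)⟩
  exact hψG ((hr _ hψ).2 rfl)

/-- Either ⟨z⟩φ holds and persists along `[o]`, or [z]¬φ holds and gives [o]¬φ by monotonicity. -/
lemma box_imp_dia {z o : I} (hzo : z < o) (φ : Formula I V) :
    GLPProvable (box o (imp φ (dia z φ))) := by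
  have h1 := GLPProvable.dia_box hzo φ
  have h2 : GLPProvable (imp (box o (dia z φ)) (box o (imp φ (dia z φ)))) :=
    GLPProvable.box_mono o (.taut fun a h _ => h)
  have h3 := GLPProvable.mono hzo.le (neg φ)
  have h4 : GLPProvable (imp (box o (neg φ)) (box o (imp φ (dia z φ)))) :=
    GLPProvable.box_mono o (.taut fun a h h' => (h h').elim)
  refine GLPProvable.of_eval fun a ha => ?_
  have h1 := ha _ h1
  have h2 := ha _ h2
  have h3 := ha _ h3
  have h4 := ha _ h4
  simp only [dia, neg, eval] at h1 h2 h3 h4 ⊢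
  tauto

lemma box_chain {z o : I} (hzo : z < o) (ψ : Formula I V) (k : ℕ) :
    GLPProvable (box o (imp (neg ψ) (dia z (chain z ψ k)))) := by
  have tr : ∀ {α β γ : Formula I V}, GLPProvable (box o (imp α β)) →
      GLPProvable (box o (imp β γ)) → GLPProvable (box o (imp α γ)) := by
    intro α β γ h1 h2
    refine ((GLPProvable.distr o _ _).mp (((GLPProvable.distr o _ _).mp
      (.nec o (.taut (φ := imp (imp α β) (imp (imp β γ) (imp α γ))) ?_))).mp h1)).mp h2
    intro a; simp only [eval]; tauto
  induction k with
  | zero =>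
    exact tr (box_imp_dia hzo _) (.nec o (GLPProvable.dia_mono z (.taut fun a _ h => h)))
  | succ k ih =>
    refine tr ?_ (box_imp_dia hzo _)
    refine (GLPProvable.box_mono o (.taut fun a => ?_)).mp ih
    simp only [chain, Formula.and, neg, eval]; tauto

end GLP

/-! ### Kripke models -/

/-- Transitive, conversely well-founded Kripke models. -/
structure Model (V : Type) where
  /-- The set of worlds. -/
  W : Type
  /-- The accessibility relation. -/
  R : W → W → Prop
  trans : ∀ {x y w}, R x y → R y w → R x w
  wf : WellFounded fun x y => R y x
  /-- The valuation. -/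
  val : W → V → Prop

/-- Truth at a world: the modality `z` is interpreted by the accessibility relation, all others
by the empty relation. -/
def Sat (z : I) (M : Model V) : M.W → Formula I V → Prop
  | w, var p => M.val w p
  | _, bot => False
  | w, imp φ ψ => Sat z M w φ → Sat z M w ψ
  | w, box i φ => i = z → ∀ u, M.R w u → Sat z M u φ

/-- Change the valuation along a substitution. -/
abbrev Model.subst (z : I) (M : Model V) (σ : V → Formula I V) : Model V where
  __ := M
  val w p := Sat z M w (σ p)

lemma sat_subst (z : I) (M : Model V) (σ : V → Formula I V) (φ : Formula I V) (w : M.W) :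
    Sat z M w (Formula.subst σ φ) ↔ Sat z (M.subst z σ) w φ := by
  induction φ generalizing w with
  | var p => rfl
  | bot => rfl
  | imp φ ψ h1 h2 => simp only [Formula.subst, Sat, h1, h2]
  | box i φ ih =>
    simp only [Formula.subst, Sat, ih]

lemma sat_of_eval (z : I) (M : Model V) (w : M.W) (φ : Formula I V) :
    eval (Sat z M w) φ ↔ Sat z M w φ := by
  induction φ with
  | var p => rfl
  | bot => rfl
  | imp φ ψ h1 h2 => simp only [eval, Sat, h1, h2]
  | box i φ ih => rfl

lemma sat_neg (z : I) (M : Model V) (w : M.W) (φ : Formula I V) :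
    Sat z M w (neg φ) ↔ ¬ Sat z M w φ := Iff.rfl

lemma sat_and (z : I) (M : Model V) (w : M.W) (φ ψ : Formula I V) :
    Sat z M w (Formula.and φ ψ) ↔ Sat z M w φ ∧ Sat z M w ψ := by
  simp only [Formula.and, neg, Sat]; tauto

lemma sat_iff (z : I) (M : Model V) (w : M.W) (φ ψ : Formula I V) :
    Sat z M w (Formula.iff φ ψ) ↔ (Sat z M w φ ↔ Sat z M w ψ) := by
  simp only [Formula.iff, sat_and, Sat]; tauto

lemma sat_dia (z : I) (M : Model V) (w : M.W) (φ : Formula I V) :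
    Sat z M w (dia z φ) ↔ ∃ u, M.R w u ∧ Sat z M u φ := by
  simp only [dia, neg, Sat, forall_const]
  refine ⟨fun h => ?_, fun ⟨u, hu, h⟩ h' => h' u hu h⟩
  by_contra hn
  exact h fun u hu h' => hn ⟨u, hu, h'⟩

/-- With z least, the empty relations for the other modalities make the mixed axioms trivial: their
conclusion is a vacuous box, unless it is the premise itself. -/
theorem GLPProvable.sound [LinearOrder I] {z : I} (hz : ∀ i, z ≤ i) {φ : Formula I V}
    (h : GLPProvable φ) (M : Model V) (w : M.W) : Sat z M w φ := by
  induction h generalizing w with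
  | taut h => exact (sat_of_eval z M w _).1 (h _)
  | distr i φ ψ => exact fun h1 h2 hi u hu => h1 hi u hu (h2 hi u hu)
  | loeb i φ =>
    intro h hi u
    induction u using M.wf.induction with
    | _ u ih => exact fun hu => h hi u hu fun _ v hv => ih v hv (M.trans hu hv)
  | dia_box hij φ => exact fun _ hj => absurd hj ((hz _).trans_lt hij).ne'
  | mono hij φ => exact fun h hj => h (le_antisymm (hj ▸ hij) (hz _))
  | mp _ _ h1 h2 => exact h1 w (h2 w)
  | nec i _ ih => exact fun _ u _ => ih u

/-- The natural numbers with the relation `>` and every variable false. -/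
abbrev natModel (V : Type) : Model V where
  W := ℕ
  R x y := y < x
  trans h1 h2 := lt_trans h2 h1
  wf := wellFounded_lt
  val _ _ := False

/-! ### Nullary type: no maximal unifier of `[1]p` -/

section NoMaximal

variable [LinearOrder I]

theorem isUnifiable_box (o : I) (p : V) : IsUnifiable (GLP I V) (box o (var p)) :=
  ⟨fun _ => neg bot, GLPProvable.nec o (.taut fun _ h => h)⟩

/-- In GLP, the formula `[1]p` has no maximal unifier. -/
theorem not_exists_isMaximalUnifier [DecidableEq V] {z o : I} (hzo : z < o)
    (hz : ∀ i, i < o → i = z) (p : V) :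
    ¬ ∃ σ, IsMaximalUnifier (GLP I V) (box o (var p)) σ := by
  rintro ⟨σ, hσ, hmax⟩
  have hz0 : ∀ i, z ≤ i := fun i => by
    by_contra h
    exact h (hz i ((not_le.1 h).trans hzo)).ge
  obtain ⟨k, hk⟩ := exists_not_chain hzo hz (ψ := σ p) hσ
  refine hmax ⟨Function.update var p (imp (neg (var p)) (dia z (chain z (var p) k))), ?_,
    ⟨σ, fun q => ?_⟩, ?_⟩
  · simp only [unifiers, Set.mem_ofPred_eq, Formula.subst, Function.update_self]
    exact box_chain hzo _ k
  · by_cases hq : q = p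
    · subst hq
      rw [Function.update_self]
      have h1 : Formula.subst σ (imp (neg (var q)) (dia z (chain z (var q) k))) =
          imp (neg (σ q)) (dia z (chain z (σ q) k)) := by
        simp only [Formula.subst, neg, dia, subst_chain]
      rw [h1]
      -- [z]¬chain_k(σ q) leaves only ¬¬σ(q) of the image of q.
      have h2 := GLPProvable.nec z hk
      refine GLPProvable.of_eval fun a ha => ?_
      have h2 := ha _ h2
      simp only [Formula.iff, Formula.and, dia, neg, eval] at h2 ⊢
      tauto
    · rw [Function.update_of_ne hq]
      refine .taut fun a => ?_
      simp only [Formula.subst, Formula.iff, Formula.and, neg, eval]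
      tauto
  · rintro ⟨θ, hθ⟩
    have hp := hθ p
    rw [Function.update_self] at hp
    have low : ∀ (l : ℕ) (x : ℕ), Sat z (natModel V) x (chain z (var p) l) → l ≤ x := by
      intro l
      induction l with
      | zero => exact fun x _ => Nat.zero_le x
      | succ l ih =>
        intro x hx
        obtain ⟨-, hx⟩ := (sat_and z (natModel V) x _ _).1 hx
        obtain ⟨u, hu, h⟩ := (sat_dia z (natModel V) x _).1 hx
        exact Nat.succ_le_of_lt ((ih u h).trans_lt hu)
    -- As p is false everywhere, the new unifier's value at x amounts to ⟨z⟩chain_k(p), which needs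
    -- x > k.
    have hfalse : ∀ x : ℕ, x ≤ k → ¬ Sat z (natModel V) x (Formula.subst θ (σ p)) := by
      intro x hx h
      rw [← (sat_iff z _ _ _ _).1 (GLPProvable.sound hz0 hp (natModel V) x)] at h
      obtain ⟨u, hu, h'⟩ := (sat_dia z (natModel V) x _).1 (h id)
      exact absurd ((low k u h').trans_lt hu) (not_lt.2 hx)
    -- The points l, …, 1 refute the instance of σ(p), and 0 is the extra endpoint that a chain of
    -- length l requires.
    have hchain : ∀ l : ℕ, l ≤ k → Sat z ((natModel V).subst z θ) l (chain z (σ p) l) := by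
      intro l
      induction l with
      | zero => exact fun _ => id
      | succ l ih =>
        intro hl
        refine (sat_and z ((natModel V).subst z θ) (l + 1 : ℕ) _ _).2
          ⟨fun h => hfalse _ hl ((sat_subst z (natModel V) θ _ _).2 h), ?_⟩
        exact (sat_dia z ((natModel V).subst z θ) (l + 1 : ℕ) _).2
          ⟨l, Nat.lt_succ_self l, ih (by omega)⟩
    exact GLPProvable.sound hz0 hk ((natModel V).subst z θ) k (hchain k le_rfl)

theorem isNullary_GLP [DecidableEq V] {z o : I} (hzo : z < o)
    (hz : ∀ i, i < o → i = z) (p : V) : IsNullary (GLP I V) := by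
  refine (isNullary_iff _).2 ⟨box o (var p), isUnifiable_box o p, ?_⟩
  rintro ⟨S, hS, hmax⟩
  obtain ⟨τ, hτ⟩ := isUnifiable_box o p
  obtain ⟨σ, hσ, -⟩ := hS.2 τ hτ
  exact not_exists_isMaximalUnifier hzo hz p ⟨σ, hmax σ hσ⟩

end NoMaximal

/-! ### Completeness of GL -/

theorem GLP_fin_one (V : Type) : GLP (Fin 1) V = GLLogic V := by
  ext φ
  constructor
  · intro h
    induction (h : GLPProvable φ) with
    | taut h => exact GLProvable.taut h
    | distr i φ ψ => rw [Subsingleton.elim i 0]; exact GLProvable.distr φ ψ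
    | loeb i φ => rw [Subsingleton.elim i 0]; exact GLProvable.loeb φ
    | dia_box hij φ => exact absurd (Subsingleton.elim _ _) hij.ne
    | @mono i j hij φ =>
      rw [Subsingleton.elim i j]
      exact GLProvable.taut fun a h => h
    | mp _ _ h1 h2 => exact GLProvable.mp h1 h2
    | nec i _ h => rw [Subsingleton.elim i 0]; exact GLProvable.nec h
  · intro h
    induction (h : GLProvable φ) with
    | taut h => exact GLPProvable.taut h
    | distr φ ψ => exact GLPProvable.distr 0 φ ψ
    | loeb φ => exact GLPProvable.loeb 0 φ
    | mp _ _ h1 h2 => exact GLPProvable.mp h1 h2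
    | nec _ h => exact GLPProvable.nec 0 h

/-- The formulas `χ` such that `[i]χ` is a subformula for some `i`. -/
def boxes : Formula I V → Set (Formula I V)
  | var _ => ∅
  | bot => ∅
  | imp φ ψ => boxes φ ∪ boxes ψ
  | box _ φ => insert φ (boxes φ)

lemma boxes_finite (φ : Formula I V) : (boxes φ).Finite := by
  induction φ with
  | var p => exact Set.finite_empty
  | bot => exact Set.finite_empty
  | imp φ ψ h1 h2 => exact h1.union h2
  | box i φ ih => exact ih.insert φ

instance (φ : Formula I V) : Finite (boxes φ) := boxes_finite φ

lemma boxes_subset {φ χ : Formula I V} (h : χ ∈ boxes φ) : boxes χ ⊆ boxes φ := by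
  induction φ with
  | var p => exact h.elim
  | bot => exact h.elim
  | imp φ ψ h1 h2 =>
    rcases h with h | h
    · exact (h1 h).trans Set.subset_union_left
    · exact (h2 h).trans Set.subset_union_right
  | box i φ ih =>
    rcases h with rfl | h
    · exact Set.subset_insert _ _
    · exact (ih h).trans (Set.subset_insert _ _)

/-- Canonical model relative to the finitely many boxes of φ. Each step must make a new one of them
true, which forces converse well-foundedness. -/
theorem GLPProvable.complete {φ : Formula (Fin 1) V}
    (h : ∀ (M : Model V) (w : M.W), Sat 0 M w φ) : GLPProvable φ := by
  by_contra hφ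
  obtain ⟨a, ha, hna⟩ := isTheory_GLP.exists_eval hφ
  let S : {a : Formula (Fin 1) V → Prop // ∀ χ, GLPProvable χ → eval a χ} → Set (boxes φ) :=
    fun a => {χ | a.1 (box 0 χ.1)}
  let M : Model V :=
    { W := {a : Formula (Fin 1) V → Prop // ∀ χ, GLPProvable χ → eval a χ}
      R := fun a b => (∀ χ ∈ boxes φ, a.1 (box 0 χ) → eval b.1 χ ∧ b.1 (box 0 χ)) ∧
        ∃ χ ∈ boxes φ, ¬ a.1 (box 0 χ) ∧ b.1 (box 0 χ)
      trans := by
        rintro a b c ⟨h1, χ, hχ, h2, h3⟩ ⟨h4, -⟩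
        exact ⟨fun ξ hξ h => h4 ξ hξ (h1 ξ hξ h).2, χ, hχ, h2, (h4 χ hχ h3).2⟩
      wf := by
        refine Subrelation.wf ?_ (InvImage.wf S (wellFounded_gt (α := Set (boxes φ))))
        rintro b a ⟨h1, χ, hχ, h2, h3⟩
        exact ⟨fun ξ hξ => (h1 ξ.1 ξ.2 hξ).2, fun h => h2 (h (a := ⟨χ, hχ⟩) h3)⟩
      val := fun a p => a.1 (var p) }
  have truth : ∀ ξ : Formula (Fin 1) V, boxes ξ ⊆ boxes φ →
      ∀ a : M.W, Sat 0 M a ξ ↔ eval a.1 ξ := by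
    intro ξ
    induction ξ with
    | var p => exact fun _ _ => Iff.rfl
    | bot => exact fun _ _ => Iff.rfl
    | imp ξ χ h1 h2 =>
      intro hs a
      simp only [Sat, eval, h1 (Set.subset_union_left.trans hs),
        h2 (Set.subset_union_right.trans hs)]
    | box i χ ih =>
      intro hs a
      obtain rfl := Subsingleton.elim i 0
      have hχ : χ ∈ boxes φ := hs (Set.mem_insert _ _)
      have ih := ih ((Set.subset_insert _ _).trans hs)
      constructor
      · intro h
        by_contra hn
        -- A successor refuting χ but satisfying [0]χ is sought. This theory collects what it must
        -- satisfy, and Löb's axiom keeps χ out of it.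
        have hT : IsTheory {ξ | a.1 (box 0 (imp (box 0 χ) ξ))} := by
          refine ⟨fun {α} hα => a.2 _ (.nec 0 ?_), fun {α β} h1 h2 => ?_⟩
          · exact GLPProvable.of_eval fun b hb _ => hb _ hα
          · have h3 : GLPProvable (imp (imp (box 0 χ) (imp α β))
                (imp (imp (box 0 χ) α) (imp (box 0 χ) β))) :=
              .taut fun b => by simp only [eval]; tauto
            exact a.2 _ (.distr 0 _ _) (a.2 _ (GLPProvable.box_mono 0 h3) h1) h2
        have hχT : χ ∉ {ξ | a.1 (box 0 (imp (box 0 χ) ξ))} := fun h => hn (a.2 _ (.loeb 0 χ) h)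
        have hT' : ∀ η, a.1 (box 0 η) → η ∈ {ξ | a.1 (box 0 (imp (box 0 χ) ξ))} := fun η h =>
          a.2 _ (GLPProvable.box_mono (φ := η) (ψ := imp (box 0 χ) η) 0 (.taut fun b h _ => h)) h
        obtain ⟨b, hb, hbχ⟩ := hT.exists_eval hχT
        let b' : M.W := ⟨b, fun ξ hξ => hb _ (hT.prov hξ)⟩
        refine hbχ ((ih b').1 (h rfl b' ⟨fun η _ hη => ⟨hb _ (hT' η hη), ?_⟩, χ, hχ, hn, ?_⟩))
        · exact hb _ (hT' _ (a.2 _ (.four 0 η) hη))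
        · exact hb (box 0 χ) (a.2 _ (.nec 0 (.taut (φ := imp (box 0 χ) (box 0 χ)) fun c h => h)))
      · exact fun h _ b hab => (ih b).2 (hab.1 χ hχ h).1
  exact hna ((truth φ subset_rfl ⟨a, ha⟩).1 (h M ⟨a, ha⟩))


/-! ### Types of worlds -/

/-- Types over `B`: a set of true variables together with a set of true boxed formulas. -/
abbrev Typ (V : Type) (B : Set (Formula (Fin 1) V)) := Set V × Set B

variable {B : Set (Formula (Fin 1) V)}

/-- The truth value of a formula in a type. -/
def Typ.ev (t : Typ V B) (φ : Formula (Fin 1) V) : Prop :=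
  eval (fun χ => match χ with
    | var p => p ∈ t.1
    | box _ χ => ∃ h : χ ∈ B, ⟨χ, h⟩ ∈ t.2
    | _ => False) φ

/-- The type of a world. -/
def Model.typ (B : Set (Formula (Fin 1) V)) (M : Model V) (w : M.W) : Typ V B :=
  ({p | M.val w p}, {χ | Sat 0 M w (box 0 χ.1)})

lemma Model.typ_ev (M : Model V) (w : M.W) {φ : Formula (Fin 1) V} (h : boxes φ ⊆ B) :
    (M.typ B w).ev φ ↔ Sat 0 M w φ := by
  induction φ with
  | var p => rfl
  | bot => rfl
  | imp φ ψ h1 h2 =>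
    exact imp_congr (h1 (Set.subset_union_left.trans h)) (h2 (Set.subset_union_right.trans h))
  | box i φ ih =>
    rw [Subsingleton.elim i 0]
    exact ⟨fun ⟨_, h⟩ => h, fun h' => ⟨h (Set.mem_insert _ _), h'⟩⟩

/-- The boxed formulas true at a world whose successors have exactly the types in `Y`. -/
def below (Y : Set (Typ V B)) : Set B := {χ | ∀ t ∈ Y, t.ev χ.1 ∧ χ ∈ t.2}

/-- The extension property. -/
def Extensible (X : Set (Typ V B)) : Prop := ∀ Y ⊆ X, ∃ a : Set V, (a, below Y) ∈ X

/-- The types realized after applying a substitution. -/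
def realized (B : Set (Formula (Fin 1) V)) (τ : V → Formula (Fin 1) V) : Set (Typ V B) :=
  {t | ∃ (M : Model V) (w : M.W), (M.subst 0 τ).typ B w = t}

/-! ### Gluing models -/

section Glue

variable {ι : Type} (M : ι → Model V) (r : ∀ i, (M i).W)

/-- The accessibility relation of the disjoint union of models with a new root below given
points. -/
inductive GlueRel : Option (Σ i, (M i).W) → Option (Σ i, (M i).W) → Prop
  | root (i : ι) : GlueRel none (some ⟨i, r i⟩)
  | above (i : ι) (u : (M i).W) : (M i).R (r i) u → GlueRel none (some ⟨i, u⟩)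
  | inner (i : ι) (u v : (M i).W) : (M i).R u v → GlueRel (some ⟨i, u⟩) (some ⟨i, v⟩)

/-- The disjoint union of models with a new root below given points. -/
abbrev glue : Model V where
  W := Option (Σ i, (M i).W)
  R := GlueRel M r
  trans := by
    intro x y w h1 h2
    cases h1 with
    | root i => cases h2 with | inner _ _ v h => exact .above i v h
    | above i u h' => cases h2 with | inner _ _ v h => exact .above i v ((M i).trans h' h)
    | inner i u v h' => cases h2 with | inner _ _ w h => exact .inner i u w ((M i).trans h' h)
  wf := by
    have h1 : ∀ i (u : (M i).W), Acc (fun x y => GlueRel M r y x) (some ⟨i, u⟩) := by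
      intro i u
      induction u using (M i).wf.induction with
      | _ u ih =>
        refine ⟨_, fun y hy => ?_⟩
        cases hy with | inner _ _ v h => exact ih v h
    refine ⟨fun x => ?_⟩
    rcases x with _ | ⟨i, u⟩
    · refine ⟨_, fun y hy => ?_⟩
      cases hy with
      | root i => exact h1 i _
      | above i u _ => exact h1 i u
    · exact h1 i u
  val
    | none, _ => False
    | some ⟨i, u⟩, p => (M i).val u p

lemma sat_glue (i : ι) (u : (M i).W) (φ : Formula (Fin 1) V) :
    Sat 0 (glue M r) (some ⟨i, u⟩ : Option (Σ i, (M i).W)) φ ↔ Sat 0 (M i) u φ := by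
  induction φ generalizing u with
  | var p => rfl
  | bot => rfl
  | imp φ ψ h1 h2 => exact imp_congr (h1 u) (h2 u)
  | box j φ ih =>
    refine imp_congr_right fun _ => ⟨fun h v hv => (ih v).1 (h _ (.inner i u v hv)), ?_⟩
    intro h v hv
    cases hv with | inner _ _ v hv => exact (ih v).2 (h v hv)

end Glue

/-- Glue worlds realizing the types in Y below a new root. The root sees these worlds and everything
above them, which accounts for both conditions in `below`; its variables are whatever τ makes them.
-/
lemma extensible_realized (hB : ∀ χ ∈ B, boxes χ ⊆ B) (τ : V → Formula (Fin 1) V) :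
    Extensible (realized B τ) := by
  intro Y hY
  choose M w hMw using fun t : Y => hY t.2
  refine ⟨_, glue M w, (none : Option (Σ i, (M i).W)), Prod.ext rfl ?_⟩
  ext χ
  have key : ∀ t : Y, (t.1.ev χ.1 ∧ χ ∈ t.1.2) ↔ Sat 0 (M t) (w t) (Formula.subst τ χ.1) ∧
      ∀ u, (M t).R (w t) u → Sat 0 (M t) u (Formula.subst τ χ.1) := by
    intro t
    simp only [sat_subst]
    rw [← hMw t, Model.typ_ev _ _ (hB _ χ.2)]
    exact and_congr_right fun _ => ⟨fun h => h rfl, fun h _ => h⟩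
  constructor
  · intro h t ht
    refine (key ⟨t, ht⟩).2 ⟨?_, fun u hu => ?_⟩
    · rw [← sat_glue M w, sat_subst]
      exact h rfl _ (GlueRel.root (M := M) (r := w) ⟨t, ht⟩)
    · rw [← sat_glue M w, sat_subst]
      exact h rfl _ (GlueRel.above (M := M) (r := w) ⟨t, ht⟩ u hu)
  · intro h _ x hx
    refine (sat_subst 0 (glue M w) τ _ x).1 ?_
    cases hx with
    | root t => exact (sat_glue M w _ _ _).2 ((key t).1 (h t t.2)).1
    | above t u hu => exact (sat_glue M w _ _ _).2 (((key t).1 (h t t.2)).2 u hu)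

/-! ### Projective substitutions -/

open Classical in
/-- Keep the valuation `a` if this realizes a type of `X`, otherwise change it if possible. -/
noncomputable def adjust (X : Set (Typ V B)) (T : Set B) (a : Set V) : Set V :=
  if (a, T) ∈ X then a else if h : ∃ b, (b, T) ∈ X then h.choose else a

lemma adjust_mem {X : Set (Typ V B)} {T : Set B} (a : Set V) (h : ∃ b, (b, T) ∈ X) :
    (adjust X T a, T) ∈ X := by
  unfold adjust
  split_ifs with h1
  · exact h1
  · exact h.choose_spec

lemma adjust_of_mem {X : Set (Typ V B)} {T : Set B} {a : Set V} (h : (a, T) ∈ X) :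
    adjust X T a = a := if_pos h

/-- The type of a world after adjusting the valuation, from the leaves downwards. -/
noncomputable def newTyp (X : Set (Typ V B)) (M : Model V) : M.W → Typ V B :=
  M.wf.fix fun w f =>
    let T : Set B := {χ | ∀ u (h : M.R w u), (f u h).ev χ.1}
    (adjust X T {p | M.val w p}, T)

lemma newTyp_snd (X : Set (Typ V B)) (M : Model V) (w : M.W) :
    (newTyp X M w).2 = {χ | ∀ u, M.R w u → (newTyp X M u).ev χ.1} := by
  rw [newTyp, WellFounded.fix_eq]

lemma newTyp_fst (X : Set (Typ V B)) (M : Model V) (w : M.W) :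
    (newTyp X M w).1 = adjust X (newTyp X M w).2 {p | M.val w p} := by
  rw [newTyp, WellFounded.fix_eq]

lemma newTyp_eq (X : Set (Typ V B)) (M : Model V) (w : M.W) :
    newTyp X M w = (adjust X (newTyp X M w).2 {p | M.val w p}, (newTyp X M w).2) :=
  Prod.ext (newTyp_fst X M w) rfl

/-- By induction the successors have types in X. Transitivity identifies the boxes true at w with
`below` of that set of types, so extensibility supplies an admissible valuation. -/
lemma newTyp_mem {X : Set (Typ V B)} (hX : Extensible X) (M : Model V) (w : M.W) :
    newTyp X M w ∈ X := by
  induction w using M.wf.induction with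
  | _ w ih =>
    rw [newTyp_eq]
    refine adjust_mem _ ?_
    obtain ⟨a, ha⟩ := hX {t | ∃ u, M.R w u ∧ newTyp X M u = t}
      (by rintro _ ⟨u, hu, rfl⟩; exact ih u hu)
    refine ⟨a, ?_⟩
    convert ha using 2
    rw [newTyp_snd]
    ext χ
    constructor
    · rintro h _ ⟨u, hu, rfl⟩
      refine ⟨h u hu, ?_⟩
      rw [newTyp_snd]
      exact fun v hv => h v (M.trans hu hv)
    · exact fun h u hu => (h _ ⟨u, hu, rfl⟩).1

/-- This makes the adjustment projective: models already inside X are left alone, whence τ ≤ σ_X. -/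
lemma newTyp_of_mem (hB : ∀ χ ∈ B, boxes χ ⊆ B) {X : Set (Typ V B)} (M : Model V)
    (h : ∀ w, M.typ B w ∈ X) (w : M.W) : newTyp X M w = M.typ B w := by
  induction w using M.wf.induction with
  | _ w ih =>
    have h2 : (newTyp X M w).2 = (M.typ B w).2 := by
      rw [newTyp_snd]
      ext χ
      refine ⟨fun h _ u hu => ?_, fun h u hu => ?_⟩
      · rw [← M.typ_ev u (hB _ χ.2), ← ih u hu]
        exact h u hu
      · rw [ih u hu, M.typ_ev u (hB _ χ.2)]
        exact h rfl u hu
    rw [newTyp_eq, h2, adjust_of_mem (T := (M.typ B w).2) (h w)]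
    rfl

lemma typ_subst_eq_newTyp (hB : ∀ χ ∈ B, boxes χ ⊆ B) {X : Set (Typ V B)}
    {σ : V → Formula (Fin 1) V} {M : Model V}
    (hσ : ∀ w p, Sat 0 M w (σ p) ↔ p ∈ (newTyp X M w).1) (w : M.W) :
    (M.subst 0 σ).typ B w = newTyp X M w := by
  induction w using M.wf.induction with
  | _ w ih =>
    refine Prod.ext (Set.ext fun p => hσ w p) ?_
    rw [newTyp_snd]
    ext χ
    refine ⟨fun h u hu => ?_, fun h _ u hu => ?_⟩
    · rw [← ih u hu, Model.typ_ev _ _ (hB _ χ.2)]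
      exact h rfl u hu
    · rw [← Model.typ_ev _ _ (hB _ χ.2), ih u hu]
      exact h u hu

/-! ### Definability -/

/-- A property of worlds that is expressed by a formula. -/
def Definable (P : ∀ M : Model V, M.W → Prop) : Prop :=
  ∃ φ : Formula (Fin 1) V, ∀ M w, Sat 0 M w φ ↔ P M w

namespace Definable

variable {P Q : ∀ M : Model V, M.W → Prop}

lemma not (hP : Definable P) : Definable fun M w => ¬ P M w := by
  obtain ⟨φ, hφ⟩ := hP
  exact ⟨neg φ, fun M w => (sat_neg 0 M w φ).trans (not_congr (hφ M w))⟩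

lemma and (hP : Definable P) (hQ : Definable Q) : Definable fun M w => P M w ∧ Q M w := by
  obtain ⟨φ, hφ⟩ := hP
  obtain ⟨ψ, hψ⟩ := hQ
  exact ⟨φ.and ψ, fun M w => (sat_and 0 M w φ ψ).trans (and_congr (hφ M w) (hψ M w))⟩

lemma congr (hP : Definable P) (h : ∀ M w, P M w ↔ Q M w) : Definable Q := by
  obtain ⟨φ, hφ⟩ := hP
  exact ⟨φ, fun M w => (hφ M w).trans (h M w)⟩

lemma or (hP : Definable P) (hQ : Definable Q) : Definable fun M w => P M w ∨ Q M w :=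
  (hP.not.and hQ.not).not.congr fun _ _ => by tauto

lemma const (c : Prop) : Definable (V := V) fun _ _ => c := by
  by_cases hc : c
  · exact ⟨neg bot, fun M w => ⟨fun _ => hc, fun _ => id⟩⟩
  · exact ⟨bot, fun M w => ⟨False.elim, hc⟩⟩

lemma finset_forall {α : Type} {P : α → ∀ M : Model V, M.W → Prop} (h : ∀ a, Definable (P a))
    (s : Finset α) : Definable fun M w => ∀ a ∈ s, P a M w := by
  classical
  induction s using Finset.induction_on with
  | empty => exact (const True).congr (by simp)
  | insert a s _ ih => exact ((h a).and ih).congr (by simp)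

lemma all {α : Type} [Finite α] {P : α → ∀ M : Model V, M.W → Prop}
    (h : ∀ a, Definable (P a)) : Definable fun M w => ∀ a, P a M w := by
  cases nonempty_fintype α
  exact (finset_forall h Finset.univ).congr (by simp)

lemma ex {α : Type} [Finite α] {P : α → ∀ M : Model V, M.W → Prop}
    (h : ∀ a, Definable (P a)) : Definable fun M w => ∃ a, P a M w :=
  (all fun a => (h a).not).not.congr (by simp)

lemma box (hP : Definable P) : Definable fun M w => ∀ u, M.R w u → P M u := by
  obtain ⟨φ, hφ⟩ := hP
  exact ⟨.box 0 φ, fun M w => by simp [Sat, hφ]⟩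

lemma val (p : V) : Definable fun M w => M.val w p := ⟨var p, fun _ _ => Iff.rfl⟩

lemma of_val [Finite V] (c : Set V → Prop) : Definable fun M w => c {p | M.val w p} := by
  have h : ∀ a : Set V, Definable fun M w => (∀ p, M.val w p ↔ p ∈ a) ∧ c a := by
    refine fun a => (all fun p => ?_).and (const _)
    by_cases hp : p ∈ a
    · exact (val p).congr (by simp [hp])
    · exact (val p).not.congr (by simp [hp])
  refine (ex h).congr fun M w => ⟨?_, fun h => ⟨_, fun p => Iff.rfl, h⟩⟩
  rintro ⟨a, ha, hc⟩
  have : {p | M.val w p} = a := Set.ext ha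
  exact this ▸ hc

end Definable

lemma Definable.newTyp_eq [Finite B] {X : Set (Typ V B)} {T : Set B}
    (h : ∀ U, T ≤ U → Definable fun M w => U ⊆ (newTyp X M w).2) :
    Definable fun M w => (newTyp X M w).2 = T := by
  have h1 : ∀ U, Definable fun M w => T < U → ¬ U ⊆ (newTyp X M w).2 := by
    intro U
    by_cases hU : T < U
    · exact (h U hU.le).not.congr (by simp [hU])
    · exact (Definable.const True).congr (by simp [hU])
  refine ((h T le_rfl).and (Definable.all h1)).congr fun M w => ?_
  refine ⟨fun ⟨h1, h2⟩ => ?_, fun h => ⟨h.ge, fun U hU hU' => hU.not_ge (h ▸ hU')⟩⟩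
  by_contra h
  exact h2 _ (lt_of_le_of_ne h1 (Ne.symm h)) subset_rfl

/-- `newTyp` is defined by recursion on worlds, of unbounded depth, so the formula is built instead
by induction from larger T to smaller. A successor has either a box set strictly above T,
expressible by induction, or T itself; in both cases its own valuation then determines its new type.
-/
lemma definable_subset_newTyp [Finite V] [Finite B] (X : Set (Typ V B)) (T : Set B) :
    Definable fun M w => T ⊆ (newTyp X M w).2 := by
  induction T using (wellFounded_gt (α := Set B)).induction with
  | _ T ih =>
    have hgt : ∀ T', Definable fun M w => T < T' ∧ (newTyp X M w).2 = T' := by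
      intro T'
      by_cases hT' : T < T'
      · exact (Definable.newTyp_eq fun U hU => ih U (hT'.trans_le hU)).congr (by simp [hT'])
      · exact (Definable.const False).congr (by simp [hT'])
    let c : Set B → Set V → Prop := fun T' a => ∀ χ ∈ T, Typ.ev (adjust X T' a, T') χ.1
    have hc : ∀ T', Definable fun M w => c T' {p | M.val w p} := fun T' => .of_val _
    refine (((Definable.ex fun T' => (hgt T').and (hc T')).or
      ((Definable.ex hgt).not.and (hc T))).box).congr fun M w => ?_
    have hcn : ∀ u, c (newTyp X M u).2 {p | M.val u p} ↔ ∀ χ ∈ T, (newTyp X M u).ev χ.1 := by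
      intro u
      conv_rhs => rw [newTyp_eq]
    -- The default case of the disjunction assumes that the box set is T, so the formula under the
    -- box is correct only where T is included. The induction over worlds below supplies this
    -- inclusion.
    have hH : ∀ u, T ⊆ (newTyp X M u).2 →
        (((∃ T', (T < T' ∧ (newTyp X M u).2 = T') ∧ c T' {p | M.val u p}) ∨
          ((¬ ∃ T', T < T' ∧ (newTyp X M u).2 = T') ∧ c T {p | M.val u p})) ↔
        ∀ χ ∈ T, (newTyp X M u).ev χ.1) := by
      intro u hu
      rw [← hcn u]
      rcases (le_iff_lt_or_eq.1 hu : T < _ ∨ T = _) with h | h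
      · constructor
        · rintro (⟨_, ⟨-, rfl⟩, h'⟩ | ⟨h', -⟩)
          · exact h'
          · exact (h' ⟨_, h, rfl⟩).elim
        · exact fun h' => .inl ⟨_, ⟨h, rfl⟩, h'⟩
      · constructor
        · rintro (⟨_, ⟨-, rfl⟩, h'⟩ | ⟨-, h'⟩)
          · exact h'
          · exact h ▸ h'
        · refine fun h' => .inr ⟨?_, h.symm ▸ h'⟩
          rintro ⟨T', h1, h2⟩
          exact h1.ne (h.trans h2)
    have hsub : ∀ w, T ⊆ (newTyp X M w).2 ↔ ∀ u, M.R w u → ∀ χ ∈ T, (newTyp X M u).ev χ.1 := by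
      intro w
      rw [newTyp_snd]
      exact ⟨fun h u hu χ hχ => h hχ u hu, fun h χ hχ u hu => h u hu χ hχ⟩
    induction w using M.wf.induction with
    | _ w ihw =>
      rw [hsub w]
      constructor
      · intro h u hu
        refine (hH u ?_).1 (h u hu)
        exact (ihw u hu).1 fun v hv => h v (M.trans hu hv)
      · intro h u hu
        refine (hH u ?_).2 (h u hu)
        exact (hsub u).2 fun v hv => h v (M.trans hu hv)

lemma exists_subst_newTyp [Finite V] [Finite B] (X : Set (Typ V B)) :
    ∃ σ : V → Formula (Fin 1) V,
      ∀ p (M : Model V) (w : M.W), Sat 0 M w (σ p) ↔ p ∈ (newTyp X M w).1 := by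
  suffices h : ∀ p, Definable fun M w => p ∈ (newTyp X M w).1 from Classical.skolem.1 h
  intro p
  have heq : ∀ T, Definable fun M w => (newTyp X M w).2 = T :=
    fun T => .newTyp_eq fun U _ => definable_subset_newTyp X U
  refine (Definable.ex fun T => (heq T).and (.of_val fun a => p ∈ adjust X T a)).congr
    fun M w => ?_
  rw [newTyp_fst]
  exact ⟨fun ⟨_, h1, h2⟩ => h1 ▸ h2, fun h => ⟨_, rfl, h⟩⟩

/-! ### Finitarity of GL -/

/-- A finite complete set of unifiers contains a complete set of maximal ones. -/
lemma IsCompleteSet.exists_maximal {I : Type} {L : Set (Formula I V)} {φ : Formula I V}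
    (refl : ∀ σ, LessGeneral L σ σ)
    (trans : ∀ {ρ σ τ}, LessGeneral L ρ σ → LessGeneral L σ τ → LessGeneral L ρ τ)
    {S : Set (V → Formula I V)} (hS : S.Finite) (hc : IsCompleteSet L φ S) :
    ∃ S', S'.Finite ∧ IsCompleteSetOfMaximal L φ S' := by
  let _ : Preorder (V → Formula I V) :=
    { le := LessGeneral L, le_refl := refl, le_trans := fun _ _ _ => trans }
  have hmax : ∀ {σ}, Maximal (· ∈ S) σ → IsMaximalUnifier L φ σ := by
    refine fun {σ} h => ⟨hc.1 h.prop, ?_⟩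
    rintro ⟨τ, hτ, h1, h2⟩
    -- By completeness a unifier above σ lies below some ρ ∈ S, and maximality of σ within S closes
    -- the circle.
    obtain ⟨ρ, hρ, h3⟩ := hc.2 τ hτ
    exact h2 (trans h3 (h.le_of_ge hρ (trans h1 h3)))
  refine ⟨{σ | Maximal (· ∈ S) σ}, hS.subset fun σ h => h.prop,
    ⟨fun σ h => hc.1 h.prop, fun τ hτ => ?_⟩, fun σ h => hmax h⟩
  obtain ⟨σ, hσ, h1⟩ := hc.2 τ hτ
  obtain ⟨ρ, h2, h3⟩ := hS.exists_le_maximal hσ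
  exact ⟨ρ, h3, trans h1 h2⟩

lemma subst_subst {I : Type} (θ θ' : V → Formula I V) (φ : Formula I V) :
    Formula.subst θ (Formula.subst θ' φ) = Formula.subst (fun p => Formula.subst θ (θ' p)) φ := by
  induction φ with
  | var p => rfl
  | bot => rfl
  | imp φ ψ h1 h2 => simp only [Formula.subst, h1, h2]
  | box i φ ih => simp only [Formula.subst, ih]

lemma mem_GLP_fin_one_iff {φ : Formula (Fin 1) V} :
    φ ∈ GLP (Fin 1) V ↔ ∀ (M : Model V) (w : M.W), Sat 0 M w φ :=
  ⟨fun h => GLPProvable.sound (z := 0) (fun _ => Fin.zero_le _) h, GLPProvable.complete⟩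

lemma lessGeneral_fin_one_iff {σ τ : V → Formula (Fin 1) V} :
    LessGeneral (GLP (Fin 1) V) σ τ ↔ ∃ θ : V → Formula (Fin 1) V,
      ∀ p (M : Model V) (w : M.W), Sat 0 M w (σ p) ↔ Sat 0 (M.subst 0 θ) w (τ p) := by
  simp only [LessGeneral, mem_GLP_fin_one_iff, sat_iff, sat_subst]

theorem isFinitary_GLP_fin_one (V : Type) [Finite V] : IsFinitary (GLP (Fin 1) V) := by
  intro φ _
  have hB : ∀ χ ∈ boxes φ, boxes χ ⊆ boxes φ := fun χ h => boxes_subset h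
  choose σ hσ using fun X : Set (Typ V (boxes φ)) => exists_subst_newTyp X
  let good : Set (Set (Typ V (boxes φ))) := {X | Extensible X ∧ ∀ t ∈ X, t.ev φ}
  refine IsCompleteSet.exists_maximal (S := σ '' good) ?_ ?_ (Set.toFinite _) ⟨?_, ?_⟩
  · exact fun τ => lessGeneral_fin_one_iff.2 ⟨var, fun p M w => Iff.rfl⟩
  · intro ρ τ υ h1 h2
    obtain ⟨θ, h1⟩ := lessGeneral_fin_one_iff.1 h1
    obtain ⟨θ', h2⟩ := lessGeneral_fin_one_iff.1 h2
    refine lessGeneral_fin_one_iff.2 ⟨fun p => Formula.subst θ (θ' p), fun p M w => ?_⟩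
    rw [h1, h2, ← sat_subst, ← sat_subst, ← sat_subst, subst_subst]
  · rintro _ ⟨X, ⟨hX, hφ⟩, rfl⟩
    refine mem_GLP_fin_one_iff.2 fun M w => ?_
    rw [sat_subst, ← Model.typ_ev (B := boxes φ) _ _ subset_rfl,
      typ_subst_eq_newTyp hB (fun w p => hσ X p M w)]
    exact hφ _ (newTyp_mem hX M w)
  · intro τ hτ
    -- Every model changed along τ has all its types in this set, so σ_X fixes it and τ itself
    -- serves as the factor θ.
    refine ⟨_, ⟨realized (boxes φ) τ, ⟨extensible_realized hB τ, ?_⟩, rfl⟩, ?_⟩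
    · rintro _ ⟨M, w, rfl⟩
      rw [Model.typ_ev _ _ subset_rfl, ← sat_subst]
      exact mem_GLP_fin_one_iff.1 hτ M w
    · refine lessGeneral_fin_one_iff.2 ⟨τ, fun p M w => ?_⟩
      rw [hσ, newTyp_of_mem hB (M.subst 0 τ) fun w => (⟨M, w, rfl⟩ : _ ∈ realized (boxes φ) τ)]
      rfl

end PolyModal

theorem mainTheorem1 :
    (∀ (n m : ℕ) (hn : 1 < n), 1 ≤ m →
      (∀ p : Fin m,
        PolyModal.IsUnifiable (PolyModal.GLP (Fin n) (Fin m))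
          (PolyModal.Formula.box ⟨1, hn⟩ (PolyModal.Formula.var p)) ∧
        ¬ ∃ σ : Fin m → PolyModal.Formula (Fin n) (Fin m),
          PolyModal.IsMaximalUnifier (PolyModal.GLP (Fin n) (Fin m))
            (PolyModal.Formula.box ⟨1, hn⟩ (PolyModal.Formula.var p)) σ) ∧
      PolyModal.IsNullary (PolyModal.GLP (Fin n) (Fin m))) ∧
    (∀ m : ℕ, 1 ≤ m →
      (∀ p : Fin m,
        PolyModal.IsUnifiable (PolyModal.GLP ℕ (Fin m))
          (PolyModal.Formula.box 1 (PolyModal.Formula.var p)) ∧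
        ¬ ∃ σ : Fin m → PolyModal.Formula ℕ (Fin m),
          PolyModal.IsMaximalUnifier (PolyModal.GLP ℕ (Fin m))
            (PolyModal.Formula.box 1 (PolyModal.Formula.var p)) σ) ∧
      PolyModal.IsNullary (PolyModal.GLP ℕ (Fin m))) ∧
    (∀ m : ℕ,
      PolyModal.GLP (Fin 1) (Fin m) = PolyModal.GLLogic (Fin m) ∧
      PolyModal.IsFinitary (PolyModal.GLP (Fin 1) (Fin m))) := by
  refine ⟨fun n m hn hm => ?_, fun m hm => ?_, fun m =>
    ⟨PolyModal.GLP_fin_one _, PolyModal.isFinitary_GLP_fin_one _⟩⟩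
  · have hzo : (⟨0, by omega⟩ : Fin n) < ⟨1, hn⟩ := Fin.mk_lt_mk.2 one_pos
    have hz : ∀ i : Fin n, i < ⟨1, hn⟩ → i = ⟨0, by omega⟩ :=
      fun i hi => Fin.ext (Nat.lt_one_iff.1 (Fin.lt_def.1 hi))
    exact ⟨fun p => ⟨PolyModal.isUnifiable_box _ p,
      PolyModal.not_exists_isMaximalUnifier hzo hz p⟩, PolyModal.isNullary_GLP hzo hz ⟨0, hm⟩⟩
  · have hz : ∀ i : ℕ, i < 1 → i = 0 := fun i hi => Nat.lt_one_iff.1 hi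
    exact ⟨fun p => ⟨PolyModal.isUnifiable_box _ p,
      PolyModal.not_exists_isMaximalUnifier one_pos hz p⟩,
      PolyModal.isNullary_GLP one_pos hz ⟨0, hm⟩⟩
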